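/- A \emph{skew brace} is a set $B$ with two group operations $\star$ and $\circ$ such that $a\circ(b\star c)=(a\circ b)\star a^{-1}\star(a\circ c)$ for all $a,b,c\in B$, where $a^{-1}$ is the inverse for $\star$; it is \emph{commutative} if $\circ$ is commutative. Morphisms are the maps that preserve both operations. (The operation $\circ$ binds more tightly than $\star$.) Let $X$ be an arbitrary set, let $M$ be the free commutative semigroup on $X$ (written with $\circ$; its elements are called monomials), and let $F$ be the free group on the set $M$, written with $\star$. For $m\in M$ let $\rho_m$ be the endomorphism of $F$ with $\rho_m(l)=(l\circ m)\star m^{-1}$ for $l\in M$, and put $u\circ m=\rho_m(u)\star m$ for $u\in F$. For $u\in F$ let $\lambda_u$ be the endomorphism of $F$ with $\lambda_u(m)=u^{-1}\star(u\circ m)$ for $m\in M$, and put $u\circ_l v=u\star\lambda_u(v)$ for $u,v\in F$. Let $N$ be the normal subgroup of $F$ generated by the elements $m^{-1}\star(m\circ l)\star l^{-1}$ with $m,l\in M$, and let $N'=[N,N]$. The operation $[u]\circ[v]=[u\circ_l v]$ is well defined on the group $F/N'$ and makes it a commutative monoid, whose neutral element is the neutral element $e$ of the group, and both brace distributivities $a\circ(b\star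 c)=a\circ b\star a^{-1}\star a\circ c$ and $(b\star c)\circ a=b\circ a\star a^{-1}\star c\circ a$ hold in $F/N'$. Let $B$ be the Grothendieck group of the monoid $(F/N',\circ)$, that is, the set of fractions $\frac{u}{v}$ with $u,v\in F/N'$, where $\frac{u}{v}=\frac{u_1}{v_1}$ if and only if $u\circ v_1\circ k=u_1\circ v\circ k$ for some $k\in F/N'$. \textbf{Theorem.} The monoid $(F/N',\circ)$ is cancellative, so that \[ \frac{u}{v}=\frac{u_1}{v_1}\iff u\circ v_1=v\circ u_1\qquad(u,v,u_1,v_1\in F/N'). \] With the well-defined operations \[ \frac{u}{v}\star\frac{u_1}{v_1}=\frac{u\circ v_1\star(v\circ v_1)^{-1}\star v\circ u_1}{v\circ v_1},\qquad \frac{u}{v}\circ\frac{u_1}{v_1}=\frac{u\circ u_1}{v\circ v_1}, \] $B$ is a commutative skew brace, and together with the map $\iota\colon X\to B$, $x\mapsto\frac{[x]}{e}$, it is the free commutative skew brace on $X$: for every commutative skew brace $C$ and every map $f\colon X\to C$ there is exactly one morphism of skew braces $\varphi\colon B\to C$ with $\varphi(\iota(x))=f(x)$ for all $x\in X$. -/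

import Mathlib

universe u v w

/-- A second binary operation `a ⊚ b` (the circle operation), next to a group operation which
is always written `a * b` and plays the role of `⋆`. The circle binds more tightly. -/
class HasCirc (W : Type u) where
  circ : W → W → W

infixl:75 " ⊚ " => HasCirc.circ

/-- A wire: a group `(W, *)` and a semigroup `(W, ⊚)` with both brace distributivities. -/
class Wire (W : Type u) extends Group W, HasCirc W where
  circ_assoc : ∀ a b c : W, a ⊚ b ⊚ c = a ⊚ (b ⊚ c)
  circ_mul : ∀ a b c : W, a ⊚ (b * c) = a ⊚ b * a⁻¹ * a ⊚ c
  mul_circ : ∀ a b c : W, (b * c) ⊚ a = b ⊚ a * a⁻¹ * c ⊚ a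

/-- A commutative wire: the circle operation is commutative. -/
class CommWire (W : Type u) extends Wire W where
  circ_comm : ∀ a b : W, a ⊚ b = b ⊚ a

/-- A skew brace: `(B, *)` and `(B, ⊚)` are groups, with left brace distributivity. -/
class SkewBrace (B : Type u) extends Group B, HasCirc B where
  circ_assoc : ∀ a b c : B, a ⊚ b ⊚ c = a ⊚ (b ⊚ c)
  circ_group : ∃ e : B, (∀ a : B, e ⊚ a = a ∧ a ⊚ e = a) ∧
    ∀ a : B, ∃ b : B, a ⊚ b = e ∧ b ⊚ a = e
  circ_mul : ∀ a b c : B, a ⊚ (b * c) = a ⊚ b * a⁻¹ * a ⊚ c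

/-- A commutative skew brace: the circle group is commutative. -/
class CommSkewBrace (B : Type u) extends SkewBrace B where
  circ_comm : ∀ a b : B, a ⊚ b = b ⊚ a

/-- Morphisms of skew braces: maps that preserve both operations. -/
structure IsSkewBraceHom {B : Type u} {C : Type v} [SkewBrace B] [SkewBrace C]
    (φ : B → C) : Prop where
  map_mul : ∀ a b : B, φ (a * b) = φ a * φ b
  map_circ : ∀ a b : B, φ (a ⊚ b) = φ a ⊚ φ b

/-- `B` together with `ι : X → B` is a free commutative skew brace on `X`, tested against the
commutative skew braces in an arbitrary universe `w`. -/
def IsFreeCommSkewBrace {X : Type u} {B : Type v} [CommSkewBrace B] (ι : X → B) : Prop :=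
  ∀ (C : Type w) [CommSkewBrace C] (f : X → C),
    ∃! φ : B → C, IsSkewBraceHom φ ∧ ∀ x : X, φ (ι x) = f x

/-! ### The free group on the free commutative semigroup -/

/-- The free commutative semigroup on `X`: nonempty finite multisets under union with
multiplicity, written multiplicatively. -/
def FreeCommSemigroup (X : Type u) : Type u := {s : Multiset X // s ≠ 0}

namespace FreeCommSemigroup

variable {X : Type u}

instance : CommSemigroup (FreeCommSemigroup X) where
  mul s t := ⟨s.1 + t.1, fun h => s.2 (add_eq_zero.1 h).1⟩
  mul_assoc s t r := Subtype.ext (add_assoc s.1 t.1 r.1)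
  mul_comm s t := Subtype.ext (add_comm s.1 t.1)

/-- The generator `x`. -/
def of (x : X) : FreeCommSemigroup X := ⟨{x}, Multiset.singleton_ne_zero x⟩

end FreeCommSemigroup

/-- The free group `F` on the set of monomials, i.e. on the free commutative semigroup. -/
abbrev PolyGroup (X : Type u) : Type u := FreeGroup (FreeCommSemigroup X)

namespace PolyGroup

variable {X : Type u}

/-- The generator of `F` given by a monomial. -/
abbrev mon (m : FreeCommSemigroup X) : PolyGroup X := FreeGroup.of m

/-- For a monomial `m`, the endomorphism `ρ_m` with `ρ_m(l) = (l ∘ m) ⋆ m⁻¹` on monomials. -/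
def rhoMon (m : FreeCommSemigroup X) : PolyGroup X →* PolyGroup X :=
  FreeGroup.lift fun l => mon (l * m) * (mon m)⁻¹

/-- `u ∘ m` for a word `u` and a monomial `m`. -/
def circMon (u : PolyGroup X) (m : FreeCommSemigroup X) : PolyGroup X :=
  rhoMon m u * mon m

/-- For a word `u`, the endomorphism `λ_u` with `λ_u(m) = u⁻¹ ⋆ (u ∘ m)` on monomials. -/
def lam (u : PolyGroup X) : PolyGroup X →* PolyGroup X :=
  FreeGroup.lift fun m => u⁻¹ * circMon u m

/-- The operation `u ∘_l v = u ⋆ λ_u(v)` on `F`. -/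
def circL (u v : PolyGroup X) : PolyGroup X := u * lam u v

/-- `N`: the normal subgroup generated by the elements `m⁻¹ ⋆ (m ∘ l) ⋆ l⁻¹`, for monomials
`m` and `l`. -/
def N (X : Type u) : Subgroup (PolyGroup X) :=
  Subgroup.normalClosure
    {w | ∃ m l : FreeCommSemigroup X, w = (mon m)⁻¹ * mon (m * l) * (mon l)⁻¹}

instance : (N X).Normal := Subgroup.normalClosure_normal

/-- `N' = [N, N]`. -/
abbrev N' (X : Type u) : Subgroup (PolyGroup X) := ⁅N X, N X⁆

theorem mk_mul_mon (m l : FreeCommSemigroup X) :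
    (QuotientGroup.mk (mon (m * l)) : PolyGroup X ⧸ N X) =
      QuotientGroup.mk (mon m) * QuotientGroup.mk (mon l) := by
  have h : (mon m)⁻¹ * mon (m * l) * (mon l)⁻¹ ∈ N X :=
    Subgroup.subset_normalClosure ⟨m, l, rfl⟩
  have h2 := (QuotientGroup.eq_one_iff _).2 h
  rw [QuotientGroup.mk_mul, QuotientGroup.mk_mul, QuotientGroup.mk_inv, QuotientGroup.mk_inv,
    mul_inv_eq_one, inv_mul_eq_iff_eq_mul] at h2
  exact h2

/-- An endomorphism of `F` that fixes the monomials modulo `N` is the identity modulo `N`. -/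
theorem mk_map_eq (φ : PolyGroup X →* PolyGroup X)
    (h : ∀ m, (QuotientGroup.mk (φ (mon m)) : PolyGroup X ⧸ N X) = QuotientGroup.mk (mon m))
    (x : PolyGroup X) : (QuotientGroup.mk (φ x) : PolyGroup X ⧸ N X) = QuotientGroup.mk x := by
  have : (QuotientGroup.mk' (N X)).comp φ = QuotientGroup.mk' (N X) :=
    FreeGroup.ext_hom _ _ h
  exact DFunLike.congr_fun this x

theorem map_N'_le (φ : PolyGroup X →* PolyGroup X)
    (h : ∀ m, (QuotientGroup.mk (φ (mon m)) : PolyGroup X ⧸ N X) = QuotientGroup.mk (mon m))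
    {x : PolyGroup X} (hx : x ∈ N' X) : φ x ∈ N' X := by
  have h1 : (N X).map φ ≤ N X := by
    rintro _ ⟨y, hy, rfl⟩
    rw [← QuotientGroup.eq_one_iff, mk_map_eq φ h, QuotientGroup.eq_one_iff]
    exact hy
  have h2 : (N' X).map φ ≤ N' X := by
    rw [Subgroup.map_commutator]
    exact Subgroup.commutator_mono h1 h1
  exact h2 ⟨x, hx, rfl⟩

theorem mk_map_congr (φ : PolyGroup X →* PolyGroup X)
    (h : ∀ m, (QuotientGroup.mk (φ (mon m)) : PolyGroup X ⧸ N X) = QuotientGroup.mk (mon m))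
    {x y : PolyGroup X} (hxy : (QuotientGroup.mk x : PolyGroup X ⧸ N' X) = QuotientGroup.mk y) :
    (QuotientGroup.mk (φ x) : PolyGroup X ⧸ N' X) = QuotientGroup.mk (φ y) := by
  rw [QuotientGroup.eq] at hxy ⊢
  rw [← map_inv, ← map_mul]
  exact map_N'_le φ h hxy

theorem rhoMon_mod (m l : FreeCommSemigroup X) :
    (QuotientGroup.mk (rhoMon m (mon l)) : PolyGroup X ⧸ N X) = QuotientGroup.mk (mon l) := by
  simp only [rhoMon, FreeGroup.lift_apply_of]
  rw [QuotientGroup.mk_mul, mk_mul_mon, QuotientGroup.mk_inv, mul_inv_cancel_right]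

theorem lam_mod (u : PolyGroup X) (m : FreeCommSemigroup X) :
    (QuotientGroup.mk (lam u (mon m)) : PolyGroup X ⧸ N X) = QuotientGroup.mk (mon m) := by
  simp only [lam, circMon, FreeGroup.lift_apply_of]
  rw [QuotientGroup.mk_mul, QuotientGroup.mk_mul, mk_map_eq _ (rhoMon_mod m),
    QuotientGroup.mk_inv, inv_mul_cancel_left]

theorem lam_congr {u u' : PolyGroup X}
    (h : (QuotientGroup.mk u : PolyGroup X ⧸ N' X) = QuotientGroup.mk u') (x : PolyGroup X) :
    (QuotientGroup.mk (lam u x) : PolyGroup X ⧸ N' X) = QuotientGroup.mk (lam u' x) := by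
  have : (QuotientGroup.mk' (N' X)).comp (lam u) = (QuotientGroup.mk' (N' X)).comp (lam u') := by
    refine FreeGroup.ext_hom _ _ fun m => ?_
    simp only [MonoidHom.comp_apply, QuotientGroup.mk'_apply, lam, circMon,
      FreeGroup.lift_apply_of, QuotientGroup.mk_mul, QuotientGroup.mk_inv, h,
      mk_map_congr _ (rhoMon_mod m) h]
  exact DFunLike.congr_fun this x

theorem circL_congr {u u' v v' : PolyGroup X}
    (hu : (QuotientGroup.mk u : PolyGroup X ⧸ N' X) = QuotientGroup.mk u')
    (hv : (QuotientGroup.mk v : PolyGroup X ⧸ N' X) = QuotientGroup.mk v') :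
    (QuotientGroup.mk (circL u v) : PolyGroup X ⧸ N' X) = QuotientGroup.mk (circL u' v') := by
  rw [circL, circL, QuotientGroup.mk_mul, QuotientGroup.mk_mul, hu, lam_congr hu,
    mk_map_congr _ (lam_mod u') hv]

end PolyGroup

/-! ### The commutative wire `F / N'` -/

/-- The quotient group `F / N'`. -/
def FreeCommWire (X : Type u) : Type u := PolyGroup X ⧸ PolyGroup.N' X

namespace FreeCommWire

open PolyGroup

variable {X : Type u}

instance : Group (FreeCommWire X) := inferInstanceAs (Group (PolyGroup X ⧸ PolyGroup.N' X))

/-- The canonical projection `F → F / N'`. -/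
def mk : PolyGroup X →* FreeCommWire X := QuotientGroup.mk' (PolyGroup.N' X)

/-- The class of the generator `x` in `F / N'`. -/
def of (x : X) : FreeCommWire X := mk (mon (FreeCommSemigroup.of x))

/-- The circle operation `[u] ∘ [v] = [u ∘_l v]` on `F / N'`. -/
instance : HasCirc (FreeCommWire X) where
  circ := Quotient.map₂ circL fun _ _ hu _ _ hv =>
    Quotient.exact (circL_congr (Quotient.sound hu) (Quotient.sound hv))

theorem mk_circ (u v : PolyGroup X) : mk u ⊚ mk v = mk (circL u v) := rfl

theorem mk_surjective : Function.Surjective (mk : PolyGroup X → FreeCommWire X) :=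
  QuotientGroup.mk'_surjective _

theorem circ_mul (a b c : FreeCommWire X) : a ⊚ (b * c) = a ⊚ b * a⁻¹ * a ⊚ c := by
  obtain ⟨u, rfl⟩ := mk_surjective a
  obtain ⟨v, rfl⟩ := mk_surjective b
  obtain ⟨w, rfl⟩ := mk_surjective c
  rw [← map_mul, mk_circ, mk_circ, mk_circ, ← map_inv, ← map_mul, ← map_mul]
  congr 1
  simp only [circL, map_mul]
  group

theorem mk_comm_of_mem {a b : PolyGroup X} (ha : a ∈ N X) (hb : b ∈ N X) :
    mk a * mk b = mk b * mk a := by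
  have h : mk (a * b * a⁻¹ * b⁻¹) = 1 :=
    (QuotientGroup.eq_one_iff _).2 (Subgroup.commutator_mem_commutator ha hb)
  rwa [map_mul, map_mul, map_mul, map_inv, map_inv, mul_inv_eq_one, mul_inv_eq_iff_eq_mul] at h

theorem conj_mod (v : PolyGroup X) (m : FreeCommSemigroup X) :
    (QuotientGroup.mk (v * mon m * v⁻¹) : PolyGroup X ⧸ N X) = QuotientGroup.mk (mon m) := by
  have h := mk_map_eq (MulAut.conj (mon m)).toMonoidHom (fun l => by
    change (QuotientGroup.mk (mon m * mon l * (mon m)⁻¹) : PolyGroup X ⧸ N X) = _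
    rw [QuotientGroup.mk_mul, QuotientGroup.mk_mul, QuotientGroup.mk_inv, ← mk_mul_mon,
      mul_comm m l, mk_mul_mon, mul_inv_cancel_right]) v
  change (QuotientGroup.mk (mon m * v * (mon m)⁻¹) : PolyGroup X ⧸ N X) = _ at h
  rw [QuotientGroup.mk_mul, QuotientGroup.mk_mul, QuotientGroup.mk_inv,
    mul_inv_eq_iff_eq_mul] at h
  rw [QuotientGroup.mk_mul, QuotientGroup.mk_mul, QuotientGroup.mk_inv, ← h,
    mul_inv_cancel_right]

theorem mk_lam_mul (u v x : PolyGroup X) :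
    mk (v * lam (u * v) x * v⁻¹) = mk (lam u x * x⁻¹ * (v * lam v x * v⁻¹)) := by
  have hv : ∀ y, (QuotientGroup.mk (v * lam v y * v⁻¹) : PolyGroup X ⧸ N X) =
      QuotientGroup.mk y := fun y => by
    have h := mk_map_eq (MulAut.conj v).toMonoidHom (conj_mod v) (lam v y)
    exact h.trans (mk_map_eq _ (lam_mod v) y)
  have hu : ∀ y, (QuotientGroup.mk (lam u y) : PolyGroup X ⧸ N X) = QuotientGroup.mk y :=
    mk_map_eq _ (lam_mod u)
  let ψ : PolyGroup X →* FreeCommWire X :=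
    MonoidHom.mk' (fun y => mk (lam u y * y⁻¹ * (v * lam v y * v⁻¹))) (by
      intro y z
      have h1 : lam u z * z⁻¹ ∈ N X := by
        rw [← QuotientGroup.eq_one_iff, QuotientGroup.mk_mul, hu, QuotientGroup.mk_inv,
          mul_inv_cancel]
      have h2 : y⁻¹ * (v * lam v y * v⁻¹) ∈ N X := by
        rw [← QuotientGroup.eq_one_iff, QuotientGroup.mk_mul, hv, QuotientGroup.mk_inv,
          inv_mul_cancel]
      have h3 := mk_comm_of_mem h1 h2
      calc mk (lam u (y * z) * (y * z)⁻¹ * (v * lam v (y * z) * v⁻¹))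
          = mk (lam u y) * (mk (lam u z * z⁻¹) * mk (y⁻¹ * (v * lam v y * v⁻¹))) *
              mk (v * lam v z * v⁻¹) := by
            rw [← map_mul, ← map_mul, ← map_mul]
            congr 1
            rw [map_mul, map_mul]
            group
        _ = mk (lam u y * y⁻¹ * (v * lam v y * v⁻¹)) *
              mk (lam u z * z⁻¹ * (v * lam v z * v⁻¹)) := by
            rw [h3, ← map_mul, ← map_mul, ← map_mul, ← map_mul]
            congr 1
            group)
  let φ : PolyGroup X →* FreeCommWire X :=
    mk.comp ((MulAut.conj v).toMonoidHom.comp (lam (u * v)))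
  have h : φ = ψ := by
    refine FreeGroup.ext_hom _ _ fun m => ?_
    change mk (v * lam (u * v) (mon m) * v⁻¹) =
      mk (lam u (mon m) * (mon m)⁻¹ * (v * lam v (mon m) * v⁻¹))
    congr 1
    simp only [lam, circMon, FreeGroup.lift_apply_of, map_mul]
    group
  exact DFunLike.congr_fun h x

theorem mul_circ (a b c : FreeCommWire X) : (b * c) ⊚ a = b ⊚ a * a⁻¹ * c ⊚ a := by
  obtain ⟨x, rfl⟩ := mk_surjective a
  obtain ⟨u, rfl⟩ := mk_surjective b
  obtain ⟨v, rfl⟩ := mk_surjective c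
  have h := mk_lam_mul u v x
  rw [← map_mul, mk_circ, mk_circ, mk_circ, ← map_inv, ← map_mul, ← map_mul]
  simp only [circL, map_mul, map_inv] at h ⊢
  rw [mul_inv_eq_iff_eq_mul] at h
  rw [mul_assoc, h]
  group

theorem circ_one (a : FreeCommWire X) : a ⊚ 1 = a := by
  have h := circ_mul a 1 1
  rw [mul_one, mul_assoc, left_eq_mul, inv_mul_eq_one] at h
  exact h.symm

theorem one_circ (a : FreeCommWire X) : 1 ⊚ a = a := by
  have h := mul_circ a 1 1
  rw [mul_one, mul_assoc, left_eq_mul, inv_mul_eq_one] at h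
  exact h.symm

theorem circ_inv (a b : FreeCommWire X) : a ⊚ b⁻¹ = a * (a ⊚ b)⁻¹ * a := by
  have h := circ_mul a b⁻¹ b
  rw [inv_mul_cancel, circ_one] at h
  exact mul_inv_eq_iff_eq_mul.1 (eq_mul_inv_of_mul_eq h.symm)

theorem inv_circ (a b : FreeCommWire X) : b⁻¹ ⊚ a = a * (b ⊚ a)⁻¹ * a := by
  have h := mul_circ a b⁻¹ b
  rw [inv_mul_cancel, one_circ] at h
  exact mul_inv_eq_iff_eq_mul.1 (eq_mul_inv_of_mul_eq h.symm)

/-- Elements of `F / N'` are generated from the monomials by `*` and inverses. -/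
theorem induction_mon {p : FreeCommWire X → Prop} (h1 : p 1) (hm : ∀ m, p (mk (mon m)))
    (hi : ∀ a, p a → p a⁻¹) (hmul : ∀ a b, p a → p b → p (a * b)) (a : FreeCommWire X) :
    p a := by
  obtain ⟨u, rfl⟩ := mk_surjective a
  induction u using FreeGroup.induction_on with
  | C1 => rw [map_one]; exact h1
  | of m => exact hm m
  | inv_of m h => rw [map_inv]; exact hi _ h
  | mul x y hx hy => rw [map_mul]; exact hmul _ _ hx hy

theorem mon_circ_mon (m l : FreeCommSemigroup X) :
    mk (mon m) ⊚ mk (mon l) = mk (mon (m * l)) := by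
  rw [mk_circ]
  simp [circL, lam, circMon, rhoMon]

theorem circ_comm (a b : FreeCommWire X) : a ⊚ b = b ⊚ a := by
  induction a using induction_mon with
  | h1 => rw [circ_one, one_circ]
  | hi a h => rw [inv_circ, circ_inv, h]
  | hmul a c ha hc => rw [mul_circ, circ_mul, ha, hc]
  | hm m =>
    induction b using induction_mon with
    | h1 => rw [circ_one, one_circ]
    | hi a h => rw [inv_circ, circ_inv, h]
    | hmul a c ha hc => rw [mul_circ, circ_mul, ha, hc]
    | hm l => rw [mon_circ_mon, mon_circ_mon, mul_comm]

theorem circ_assoc (a b c : FreeCommWire X) : a ⊚ b ⊚ c = a ⊚ (b ⊚ c) := by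
  induction a using induction_mon with
  | h1 => rw [one_circ, one_circ]
  | hi a h => simp only [inv_circ, mul_circ, h]; group
  | hmul a d ha hd => simp only [mul_circ, ha, hd, inv_circ]; group
  | hm m =>
    induction b using induction_mon with
    | h1 => rw [circ_one, one_circ]
    | hi a h => simp only [inv_circ, circ_inv, mul_circ, circ_mul, h]; group
    | hmul a d ha hd => simp only [mul_circ, circ_mul, ha, hd, inv_circ, circ_inv]; group
    | hm l =>
      induction c using induction_mon with
      | h1 => rw [circ_one, circ_one]
      | hi a h => simp only [circ_inv, circ_mul, h]; group
      | hmul a d ha hd => simp only [circ_mul, ha, hd, circ_inv]; group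
      | hm k => rw [mon_circ_mon, mon_circ_mon, mon_circ_mon, mon_circ_mon, mul_assoc]

instance : CommWire (FreeCommWire X) where
  circ_assoc := circ_assoc
  circ_mul := circ_mul
  mul_circ := mul_circ
  circ_comm := circ_comm

end FreeCommWire

/-! ### The skew brace of fractions of a commutative wire -/

namespace CommWire

variable {W : Type u} [CommWire W]

instance : Std.Associative (HasCirc.circ : W → W → W) := ⟨Wire.circ_assoc⟩

instance : Std.Commutative (HasCirc.circ : W → W → W) := ⟨CommWire.circ_comm⟩

theorem circ_one (a : W) : a ⊚ 1 = a := by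
  have h := Wire.circ_mul a 1 1
  rw [mul_one, mul_assoc, left_eq_mul, inv_mul_eq_one] at h
  exact h.symm

theorem one_circ (a : W) : 1 ⊚ a = a := by
  rw [circ_comm, circ_one]

theorem circ_inv (a b : W) : a ⊚ b⁻¹ = a * (a ⊚ b)⁻¹ * a := by
  have h := Wire.circ_mul a b⁻¹ b
  rw [inv_mul_cancel, circ_one] at h
  exact mul_inv_eq_iff_eq_mul.1 (eq_mul_inv_of_mul_eq h.symm)

theorem circ_truss (x a b c : W) : x ⊚ (a * b⁻¹ * c) = x ⊚ a * (x ⊚ b)⁻¹ * x ⊚ c := by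
  rw [Wire.circ_mul, Wire.circ_mul, circ_inv]
  group

theorem truss_circ (x a b c : W) : (a * b⁻¹ * c) ⊚ x = a ⊚ x * (b ⊚ x)⁻¹ * c ⊚ x := by
  rw [circ_comm, circ_truss, circ_comm x, circ_comm x, circ_comm x]

theorem circ_left_comm (a b c : W) : a ⊚ (b ⊚ c) = b ⊚ (a ⊚ c) := by ac_rfl

/-- `(u, v) ∼ (u₁, v₁)` iff `u ∘ v₁ ∘ k = u₁ ∘ v ∘ k` for some `k`: the equivalence relation
that defines the Grothendieck group of the commutative monoid `(W, ∘)`. -/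
def fracSetoid (W : Type u) [CommWire W] : Setoid (W × W) where
  r p q := ∃ k : W, p.1 ⊚ q.2 ⊚ k = q.1 ⊚ p.2 ⊚ k
  iseqv :=
    { refl := fun _ => ⟨1, rfl⟩
      symm := fun ⟨k, h⟩ => ⟨k, h.symm⟩
      trans := by
        rintro ⟨u, v⟩ ⟨x, y⟩ ⟨z, t⟩ ⟨k, h⟩ ⟨l, h'⟩
        refine ⟨y ⊚ k ⊚ l, ?_⟩
        dsimp only at h h' ⊢
        calc u ⊚ t ⊚ (y ⊚ k ⊚ l) = (u ⊚ y ⊚ k) ⊚ (t ⊚ l) := by ac_rfl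
          _ = (x ⊚ v ⊚ k) ⊚ (t ⊚ l) := by rw [h]
          _ = (x ⊚ t ⊚ l) ⊚ (v ⊚ k) := by ac_rfl
          _ = (z ⊚ y ⊚ l) ⊚ (v ⊚ k) := by rw [h']
          _ = z ⊚ v ⊚ (y ⊚ k ⊚ l) := by ac_rfl }

end CommWire

open CommWire in
/-- The set of fractions `u / v` with `u, v ∈ W`. -/
def Fractions (W : Type u) [CommWire W] : Type u := Quotient (fracSetoid W)

namespace Fractions

open CommWire

variable {W : Type u} [CommWire W]

/-- The fraction `u / v`. -/
def frac (u v : W) : Fractions W := Quotient.mk (fracSetoid W) (u, v)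

theorem frac_eq {u v x y : W} (k : W) (h : u ⊚ y ⊚ k = x ⊚ v ⊚ k) : frac u v = frac x y :=
  Quotient.sound (s := fracSetoid W) ⟨k, h⟩

theorem exists_frac (a : Fractions W) : ∃ u v : W, a = frac u v := by
  induction a using Quotient.inductionOn with
  | h p => exact ⟨p.1, p.2, rfl⟩

/-- `u / v ∘ u₁ / v₁ = (u ∘ u₁) / (v ∘ v₁)`. -/
instance : HasCirc (Fractions W) where
  circ := Quotient.map₂ (fun p q => (p.1 ⊚ q.1, p.2 ⊚ q.2)) <| by
    rintro ⟨u, v⟩ ⟨x, y⟩ ⟨k, h⟩ ⟨u₁, v₁⟩ ⟨x₁, y₁⟩ ⟨k₁, h₁⟩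
    refine ⟨k ⊚ k₁, ?_⟩
    dsimp only at h h₁ ⊢
    calc u ⊚ u₁ ⊚ (y ⊚ y₁) ⊚ (k ⊚ k₁) = (u ⊚ y ⊚ k) ⊚ (u₁ ⊚ y₁ ⊚ k₁) := by ac_rfl
      _ = (x ⊚ v ⊚ k) ⊚ (x₁ ⊚ v₁ ⊚ k₁) := by rw [h, h₁]
      _ = x ⊚ x₁ ⊚ (v ⊚ v₁) ⊚ (k ⊚ k₁) := by ac_rfl

/-- `u / v ⋆ u₁ / v₁ = ((u ∘ v₁) ⋆ (v ∘ v₁)⁻¹ ⋆ (u₁ ∘ v)) / (v ∘ v₁)`. -/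
instance : Mul (Fractions W) where
  mul := Quotient.map₂
    (fun p q => (p.1 ⊚ q.2 * (p.2 ⊚ q.2)⁻¹ * q.1 ⊚ p.2, p.2 ⊚ q.2)) <| by
    rintro ⟨u, v⟩ ⟨x, y⟩ ⟨k, h⟩ ⟨u₁, v₁⟩ ⟨x₁, y₁⟩ ⟨k₁, h₁⟩
    refine ⟨k ⊚ k₁, ?_⟩
    dsimp only at h h₁ ⊢
    have e₁ : y ⊚ y₁ ⊚ (k ⊚ k₁) ⊚ (u ⊚ v₁) = v ⊚ v₁ ⊚ (k ⊚ k₁) ⊚ (x ⊚ y₁) := by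
      calc _ = (u ⊚ y ⊚ k) ⊚ (v₁ ⊚ y₁ ⊚ k₁) := by ac_rfl
        _ = (x ⊚ v ⊚ k) ⊚ (v₁ ⊚ y₁ ⊚ k₁) := by rw [h]
        _ = _ := by ac_rfl
    have e₂ : y ⊚ y₁ ⊚ (k ⊚ k₁) ⊚ (v ⊚ v₁) = v ⊚ v₁ ⊚ (k ⊚ k₁) ⊚ (y ⊚ y₁) := by ac_rfl
    have e₃ : y ⊚ y₁ ⊚ (k ⊚ k₁) ⊚ (u₁ ⊚ v) = v ⊚ v₁ ⊚ (k ⊚ k₁) ⊚ (x₁ ⊚ y) := by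
      calc _ = (u₁ ⊚ y₁ ⊚ k₁) ⊚ (v ⊚ y ⊚ k) := by ac_rfl
        _ = (x₁ ⊚ v₁ ⊚ k₁) ⊚ (v ⊚ y ⊚ k) := by rw [h₁]
        _ = _ := by ac_rfl
    calc _ = y ⊚ y₁ ⊚ (k ⊚ k₁) ⊚ (u ⊚ v₁ * (v ⊚ v₁)⁻¹ * u₁ ⊚ v) := by ac_rfl
      _ = v ⊚ v₁ ⊚ (k ⊚ k₁) ⊚ (x ⊚ y₁ * (y ⊚ y₁)⁻¹ * x₁ ⊚ y) := by
        rw [circ_truss, circ_truss, e₁, e₂, e₃]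
      _ = _ := by ac_rfl

/-- The neutral element `e / e`. -/
instance : One (Fractions W) := ⟨frac 1 1⟩

/-- The inverse of `u / v` for `⋆` is `(v ⋆ u⁻¹ ⋆ v) / v`. -/
instance : Inv (Fractions W) where
  inv := Quotient.map (fun p => (p.2 * p.1⁻¹ * p.2, p.2)) <| by
    rintro ⟨u, v⟩ ⟨x, y⟩ ⟨k, h⟩
    refine ⟨k, ?_⟩
    dsimp only at h ⊢
    have e₁ : y ⊚ k ⊚ u = v ⊚ k ⊚ x := by
      calc _ = u ⊚ y ⊚ k := by ac_rfl
        _ = x ⊚ v ⊚ k := h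
        _ = _ := by ac_rfl
    have e₂ : y ⊚ k ⊚ v = v ⊚ k ⊚ y := by ac_rfl
    calc _ = y ⊚ k ⊚ (v * u⁻¹ * v) := by ac_rfl
      _ = v ⊚ k ⊚ (y * x⁻¹ * y) := by rw [circ_truss, circ_truss, e₁, e₂]
      _ = _ := by ac_rfl

theorem frac_circ (u v x y : W) : frac u v ⊚ frac x y = frac (u ⊚ x) (v ⊚ y) := rfl

theorem frac_mul (u v x y : W) :
    frac u v * frac x y = frac (u ⊚ y * (v ⊚ y)⁻¹ * x ⊚ v) (v ⊚ y) := rfl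

theorem frac_inv (u v : W) : (frac u v)⁻¹ = frac (v * u⁻¹ * v) v := rfl

theorem one_def : (1 : Fractions W) = frac 1 1 := rfl

instance : Group (Fractions W) :=
  Group.ofLeftAxioms
    (by
      intro a b c
      obtain ⟨u, v, rfl⟩ := exists_frac a
      obtain ⟨x, y, rfl⟩ := exists_frac b
      obtain ⟨z, t, rfl⟩ := exists_frac c
      rw [frac_mul, frac_mul, frac_mul, frac_mul, truss_circ, truss_circ]
      simp only [circ_comm, circ_left_comm, mul_assoc])
    (by
      intro a
      obtain ⟨u, v, rfl⟩ := exists_frac a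
      rw [one_def, frac_mul, one_circ, circ_one, mul_inv_cancel, one_mul])
    (by
      intro a
      obtain ⟨u, v, rfl⟩ := exists_frac a
      rw [frac_inv, frac_mul, truss_circ, mul_inv_cancel_right, inv_mul_cancel_right, one_def]
      exact frac_eq 1 (by ac_rfl))

/-- The skew brace of fractions of a commutative wire. -/
instance : CommSkewBrace (Fractions W) where
  circ_assoc a b c := by
    obtain ⟨u, v, rfl⟩ := exists_frac a
    obtain ⟨x, y, rfl⟩ := exists_frac b
    obtain ⟨z, t, rfl⟩ := exists_frac c
    simp only [frac_circ, Wire.circ_assoc]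
  circ_comm a b := by
    obtain ⟨u, v, rfl⟩ := exists_frac a
    obtain ⟨x, y, rfl⟩ := exists_frac b
    rw [frac_circ, frac_circ, circ_comm u, circ_comm v]
  circ_group := by
    refine ⟨1, fun a => ?_, fun a => ?_⟩
    · obtain ⟨u, v, rfl⟩ := exists_frac a
      rw [one_def, frac_circ, frac_circ, one_circ, one_circ, circ_one, circ_one]
      exact ⟨rfl, rfl⟩
    · obtain ⟨u, v, rfl⟩ := exists_frac a
      refine ⟨frac v u, ?_, ?_⟩ <;> rw [one_def, frac_circ] <;>
        exact frac_eq 1 (by ac_rfl)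
  circ_mul a b c := by
    obtain ⟨u, v, rfl⟩ := exists_frac a
    obtain ⟨x, y, rfl⟩ := exists_frac b
    obtain ⟨z, t, rfl⟩ := exists_frac c
    rw [frac_inv, frac_circ, frac_circ, frac_mul, frac_circ, frac_mul, frac_mul]
    refine frac_eq 1 ?_
    simp only [circ_one, truss_circ, circ_truss]
    simp only [circ_comm, circ_left_comm]
    group

end Fractions

/-!
The universal property comes from two adjunctions. In a commutative wire the defects
`a⁻¹ ⋆ (a ∘ b) ⋆ b⁻¹` generate a normal subgroup, and they commute with each other because
`(c ⋆ b) ∘ (a ⋆ d)` can be expanded in two ways. Hence the evaluation of words in a commutative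
wire kills `N'`, and `F / N'` is the free commutative wire on `X`; on the other hand, a morphism
from a commutative wire to a commutative skew brace extends uniquely to the fractions.

For cancellation, observe that the affine maps `z ↦ u (z - 1) + y` of a commutative ring `R` form
a commutative wire when `∘` multiplies both the linear parts `u` and the values `y` at `1`. Over
the group ring of `F / N × (free commutative monoid on X)` the monomials `m` act by
`z ↦ [m] (z - 1) + m`, which gives a morphism from `F / N'` into such a wire. It is injective by
Magnus' theorem on `F / [N, N]`. Since `F / N` is free abelian, the group ring is a domain, and
all the values at `1` have augmentation `1`, so that they are nonzero and can be cancelled.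
-/

/-! ### Morphisms of wires -/

instance CommSkewBrace.toCommWire {C : Type w} [CommSkewBrace C] : CommWire C where
  circ_assoc := SkewBrace.circ_assoc
  circ_mul := SkewBrace.circ_mul
  mul_circ a b c := by
    rw [CommSkewBrace.circ_comm (b * c), CommSkewBrace.circ_comm b, CommSkewBrace.circ_comm c,
      SkewBrace.circ_mul]
  circ_comm := CommSkewBrace.circ_comm

/-- Morphisms of wires: group homomorphisms that preserve the circle operation. -/
structure WireHom (V : Type u) (W : Type v) [Wire V] [Wire W] extends V →* W where
  map_circ' : ∀ a b : V, toFun (a ⊚ b) = toFun a ⊚ toFun b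

namespace WireHom

instance {V : Type u} {W : Type v} [Wire V] [Wire W] : FunLike (WireHom V W) V W where
  coe φ := φ.toFun
  coe_injective φ ψ h := by
    cases φ
    cases ψ
    congr
    exact DFunLike.coe_injective h

instance {V : Type u} {W : Type v} [Wire V] [Wire W] : MonoidHomClass (WireHom V W) V W where
  map_mul φ := φ.map_mul'
  map_one φ := φ.map_one'

theorem map_circ {V : Type u} {W : Type v} [Wire V] [Wire W] (φ : WireHom V W) (a b : V) :
    φ (a ⊚ b) = φ a ⊚ φ b :=
  φ.map_circ' a b

/-- The composition of two morphisms of wires. -/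
def comp {U : Type w} {V : Type u} {W : Type v} [Wire U] [Wire V] [Wire W] (ψ : WireHom V W)
    (φ : WireHom U V) : WireHom U W where
  toMonoidHom := ψ.toMonoidHom.comp φ.toMonoidHom
  map_circ' a b := (congrArg ψ (φ.map_circ a b)).trans (ψ.map_circ (φ a) (φ b))

theorem isSkewBraceHom {B : Type u} {C : Type v} [CommSkewBrace B] [CommSkewBrace C]
    (φ : WireHom B C) : IsSkewBraceHom φ :=
  ⟨map_mul φ, φ.map_circ⟩

end WireHom

/-- A morphism of commutative skew braces, as a morphism of the underlying wires. -/
def IsSkewBraceHom.toWireHom {B : Type u} {C : Type v} [CommSkewBrace B] [CommSkewBrace C]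
    {φ : B → C} (hφ : IsSkewBraceHom φ) : WireHom B C where
  toMonoidHom := MonoidHom.mk' φ hφ.map_mul
  map_circ' := hφ.map_circ

namespace Wire

/-- The endomorphism `λ_a(b) = a⁻¹ ⋆ (a ∘ b)` of the group of a wire. It turns statements about
the circle operation into statements about group homomorphisms. -/
def lam {W : Type u} [Wire W] (a : W) : W →* W :=
  MonoidHom.mk' (fun b => a⁻¹ * a ⊚ b) fun b c => by simp only [circ_mul, mul_assoc]

theorem lam_apply {W : Type u} [Wire W] (a b : W) : lam a b = a⁻¹ * a ⊚ b := rfl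

theorem map_circ_of_closure_eq_top {V : Type u} {W : Type v} [Wire V] [Wire W] {φ : V →* W}
    {S : Set V} (hS : Subgroup.closure S = ⊤) {a : V} (h : ∀ s ∈ S, φ (a ⊚ s) = φ a ⊚ φ s)
    (b : V) : φ (a ⊚ b) = φ a ⊚ φ b := by
  have hlam : φ.comp (lam a) = (lam (φ a)).comp φ :=
    MonoidHom.eq_of_eqOn_dense hS fun s hs => by
      simp only [MonoidHom.comp_apply, lam_apply, map_mul, map_inv, h s hs]
  simpa only [MonoidHom.comp_apply, lam_apply, map_mul, map_inv, mul_right_inj] using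
    DFunLike.congr_fun hlam b

end Wire

namespace CommWire

theorem map_circ_of_closure_eq_top {V : Type u} {W : Type v} [CommWire V] [CommWire W]
    {φ : V →* W} {S : Set V} (hS : Subgroup.closure S = ⊤)
    (h : ∀ s ∈ S, ∀ t ∈ S, φ (s ⊚ t) = φ s ⊚ φ t) (a b : V) : φ (a ⊚ b) = φ a ⊚ φ b := by
  refine Wire.map_circ_of_closure_eq_top hS (fun t ht => ?_) b
  rw [circ_comm a, circ_comm (φ a)]
  exact Wire.map_circ_of_closure_eq_top hS (fun s hs => h t ht s hs) a

/-! ### Defects -/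

variable {W : Type u} [CommWire W]

/-- The element `a⁻¹ ⋆ (a ∘ b) ⋆ b⁻¹`, which measures by how much the two operations differ. -/
def defect (a b : W) : W := a⁻¹ * a ⊚ b * b⁻¹

theorem defect_mul_comm (a b c d : W) :
    defect a b * defect c d = defect c d * defect a b := by
  have left_first : (c * b) ⊚ (a * d) =
      c ⊚ a * a⁻¹ * b ⊚ a * (b⁻¹ * c⁻¹) * (c ⊚ d * d⁻¹ * b ⊚ d) := by
    rw [Wire.circ_mul, Wire.mul_circ, Wire.mul_circ, mul_inv_rev]
  have right_first : (c * b) ⊚ (a * d) =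
      c ⊚ a * c⁻¹ * c ⊚ d * (d⁻¹ * a⁻¹) * (b ⊚ a * b⁻¹ * b ⊚ d) := by
    rw [Wire.mul_circ, Wire.circ_mul, Wire.circ_mul, mul_inv_rev]
  have h := congrArg (fun x => (c ⊚ a)⁻¹ * x * (b ⊚ d)⁻¹) (left_first.symm.trans right_first)
  simpa only [defect, circ_comm a b, mul_assoc, inv_mul_cancel_left, mul_inv_cancel, mul_one]
    using h

theorem conj_defect (a b c : W) :
    b * defect a c * b⁻¹ = (defect a b)⁻¹ * defect a (b * c) := by
  rw [defect, defect, defect, Wire.circ_mul]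
  group

/-- The subgroup generated by all the defects: the smallest normal subgroup modulo which the two
operations of the wire agree. -/
def defectSubgroup (W : Type u) [CommWire W] : Subgroup W :=
  Subgroup.closure {x | ∃ a b : W, x = defect a b}

theorem defect_mem_defectSubgroup (a b : W) : defect a b ∈ defectSubgroup W :=
  Subgroup.subset_closure ⟨a, b, rfl⟩

instance : (defectSubgroup W).Normal where
  conj_mem x hx g := by
    suffices h : defectSubgroup W ≤ (defectSubgroup W).comap (MulAut.conj g).toMonoidHom from h hx
    refine (Subgroup.closure_le _).2 ?_
    rintro _ ⟨a, b, rfl⟩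
    change g * defect a b * g⁻¹ ∈ defectSubgroup W
    rw [conj_defect]
    exact mul_mem (inv_mem (defect_mem_defectSubgroup _ _)) (defect_mem_defectSubgroup _ _)

theorem commutator_defectSubgroup : ⁅defectSubgroup W, defectSubgroup W⁆ = ⊥ := by
  rw [Subgroup.commutator_eq_bot_iff_le_centralizer, defectSubgroup,
    Subgroup.centralizer_closure, Subgroup.closure_le]
  rintro _ ⟨a, b, rfl⟩ _ ⟨c, d, rfl⟩
  exact defect_mul_comm _ _ _ _

end CommWire

/-! ### The free commutative wire -/

theorem FreeCommSemigroup.induction_on {X : Type u} {p : FreeCommSemigroup X → Prop}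
    (of : ∀ x, p (of x)) (of_mul : ∀ x m, p m → p (FreeCommSemigroup.of x * m))
    (m : FreeCommSemigroup X) : p m := by
  obtain ⟨s, hs⟩ := m
  induction s using Multiset.induction_on with
  | empty => exact absurd rfl hs
  | cons x s ih =>
    obtain rfl | h := eq_or_ne s 0
    · exact of x
    · exact of_mul x ⟨s, h⟩ (ih h)

namespace FreeCommWire

open PolyGroup

variable {X : Type u} {W : Type w} [CommWire W]

theorem closure_range_mon :
    Subgroup.closure (Set.range fun m => (mk (mon m) : FreeCommWire X)) = ⊤ := by
  change Subgroup.closure (Set.range (mk ∘ FreeGroup.of)) = ⊤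
  rw [Set.range_comp, ← MonoidHom.map_closure, FreeGroup.closure_range_of,
    ← MonoidHom.range_eq_map]
  exact MonoidHom.range_eq_top.2 mk_surjective

theorem commutator_N_le_ker_freeGroupLift {g : FreeCommSemigroup X → W}
    (hg : ∀ m l, g (m * l) = g m ⊚ g l) : N' X ≤ (FreeGroup.lift g).ker := by
  have map_N_le : (N X).map (FreeGroup.lift g) ≤ CommWire.defectSubgroup W := by
    refine Subgroup.map_le_iff_le_comap.2 (Subgroup.normalClosure_le_normal ?_)
    rintro _ ⟨m, l, rfl⟩
    have map_relator : FreeGroup.lift g ((mon m)⁻¹ * mon (m * l) * (mon l)⁻¹) =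
        CommWire.defect (g m) (g l) := by
      simp only [map_mul, map_inv, FreeGroup.lift_apply_of, hg, CommWire.defect]
    exact Subgroup.mem_comap.2 (map_relator ▸ CommWire.defect_mem_defectSubgroup _ _)
  rw [← MonoidHom.comap_bot, ← CommWire.commutator_defectSubgroup,
    ← Subgroup.map_le_iff_le_comap, Subgroup.map_commutator]
  exact Subgroup.commutator_mono map_N_le map_N_le

/-- The extension to `F / N'` of a map on monomials that turns their product into the circle
operation of a commutative wire. -/
def liftMon (g : FreeCommSemigroup X → W) (hg : ∀ m l, g (m * l) = g m ⊚ g l) :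
    WireHom (FreeCommWire X) W where
  toMonoidHom :=
    QuotientGroup.lift (N' X) (FreeGroup.lift g) (commutator_N_le_ker_freeGroupLift hg)
  map_circ' := CommWire.map_circ_of_closure_eq_top closure_range_mon <| by
    rintro _ ⟨m, rfl⟩ _ ⟨l, rfl⟩
    rw [mon_circ_mon]
    change FreeGroup.lift g (mon (m * l)) = FreeGroup.lift g (mon m) ⊚ FreeGroup.lift g (mon l)
    simp only [FreeGroup.lift_apply_of, hg]

theorem liftMon_mon (g : FreeCommSemigroup X → W) (hg : ∀ m l, g (m * l) = g m ⊚ g l)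
    (m : FreeCommSemigroup X) : liftMon g hg (mk (mon m)) = g m :=
  FreeGroup.lift_apply_of

/-- The value of a monomial under the substitution `f` of the variables. -/
def evalMon (f : X → W) (m : FreeCommSemigroup X) : W := Multiset.fold (· ⊚ ·) 1 (m.1.map f)

theorem evalMon_of (f : X → W) (x : X) : evalMon f (FreeCommSemigroup.of x) = f x :=
  CommWire.circ_one (f x)

theorem evalMon_mul (f : X → W) (m l : FreeCommSemigroup X) :
    evalMon f (m * l) = evalMon f m ⊚ evalMon f l := by
  change Multiset.fold _ 1 ((m.1 + l.1).map f) = _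
  rw [Multiset.map_add]
  conv_lhs => rw [← CommWire.circ_one (1 : W)]
  exact Multiset.fold_add _ _ _ _ _

/-- The extension of a substitution `f` of the variables to `F / N'`. -/
def lift (f : X → W) : WireHom (FreeCommWire X) W := liftMon (evalMon f) (evalMon_mul f)

theorem lift_of (f : X → W) (x : X) : lift f (of x) = f x :=
  (liftMon_mon _ _ _).trans (evalMon_of f x)

theorem hom_eq_of_eq_on_of {V : Type w} [Wire V] {φ ψ : WireHom (FreeCommWire X) V}
    (h : ∀ x, φ (of x) = ψ (of x)) : φ = ψ := by
  have eq_on_mon (m : FreeCommSemigroup X) : φ (mk (mon m)) = ψ (mk (mon m)) := by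
    induction m using FreeCommSemigroup.induction_on with
    | of x => exact h x
    | of_mul x m ih =>
      rw [← mon_circ_mon, φ.map_circ, ψ.map_circ, ih]
      exact congrArg (· ⊚ _) (h x)
  have eq_monoidHom : φ.toMonoidHom = ψ.toMonoidHom :=
    MonoidHom.eq_of_eqOn_dense closure_range_mon <| Set.forall_mem_range.2 eq_on_mon
  exact DFunLike.ext _ _ fun a => DFunLike.congr_fun eq_monoidHom a

end FreeCommWire

/-! ### Fractions -/

namespace CommSkewBrace

variable {C : Type w} [CommSkewBrace C]

theorem exists_circ_eq_one (a : C) : ∃ b : C, a ⊚ b = 1 := by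
  obtain ⟨e, he, hinv⟩ := SkewBrace.circ_group (B := C)
  obtain ⟨b, hb, -⟩ := hinv a
  exact ⟨b, by rw [hb, ← (he 1).1, CommWire.circ_one]⟩

/-- The inverse for the circle operation. -/
noncomputable def circInv (a : C) : C := (exists_circ_eq_one a).choose

theorem circ_circInv (a : C) : a ⊚ circInv a = 1 := (exists_circ_eq_one a).choose_spec

theorem circ_circInv_cancel_right (a b : C) : a ⊚ b ⊚ circInv b = a := by
  rw [Wire.circ_assoc, circ_circInv, CommWire.circ_one]

theorem circ_right_cancel {a b c : C} (h : a ⊚ c = b ⊚ c) : a = b := by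
  rw [← circ_circInv_cancel_right a c, h, circ_circInv_cancel_right]

theorem eq_circ_circInv_iff {a b c : C} : a = b ⊚ circInv c ↔ a ⊚ c = b := by
  have h : b ⊚ circInv c ⊚ c = b := by
    rw [Wire.circ_assoc, CommWire.circ_comm _ c, circ_circInv, CommWire.circ_one]
  exact ⟨fun e => e ▸ h, fun e => circ_right_cancel (e.trans h.symm)⟩

end CommSkewBrace

namespace Fractions

open CommWire CommSkewBrace

variable {W : Type u} [CommWire W]

theorem frac_eq_frac_iff (cancel : ∀ a b c : W, a ⊚ c = b ⊚ c → a = b) {a b a₁ b₁ : W} :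
    frac a b = frac a₁ b₁ ↔ a ⊚ b₁ = b ⊚ a₁ := by
  rw [circ_comm b]
  refine ⟨fun h => ?_, fun h => frac_eq 1 (by rw [h])⟩
  obtain ⟨k, hk⟩ := Quotient.exact (s := fracSetoid W) h
  exact cancel _ _ k hk

/-- The canonical morphism `a ↦ a / e`. -/
def of (W : Type u) [CommWire W] : WireHom W (Fractions W) where
  toMonoidHom := MonoidHom.mk' (fun a => frac a 1) fun a b => by
    rw [frac_mul, circ_one, circ_one, circ_one, inv_one, mul_one]
  map_circ' a b := by
    change frac (a ⊚ b) 1 = frac a 1 ⊚ frac b 1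
    rw [frac_circ, circ_one]

theorem of_apply (a : W) : of W a = frac a 1 := rfl

theorem frac_circ_of (a b : W) : frac a b ⊚ of W b = of W a := by
  rw [of_apply, of_apply, frac_circ]
  exact frac_eq 1 (by simp only [circ_one])

variable {C : Type w} [CommSkewBrace C] (φ : WireHom W C)

/-- The value `φ a ∘ (φ b)⁻¹` of the fraction `a / b`, the inverse being that of `∘`. -/
noncomputable def liftFun : Fractions W → C :=
  Quotient.lift (fun p => φ p.1 ⊚ circInv (φ p.2)) <| by
    rintro ⟨a, b⟩ ⟨c, d⟩ ⟨k, h⟩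
    have cross : φ a ⊚ φ d = φ c ⊚ φ b := by
      refine circ_right_cancel (c := φ k) ?_
      simpa only [φ.map_circ] using congrArg φ h
    dsimp only
    refine eq_circ_circInv_iff.2 ?_
    calc φ a ⊚ circInv (φ b) ⊚ φ d = φ a ⊚ φ d ⊚ circInv (φ b) := by ac_rfl
      _ = φ c ⊚ φ b ⊚ circInv (φ b) := by rw [cross]
      _ = φ c := circ_circInv_cancel_right _ _

theorem eq_liftFun_frac_iff {a b : W} {c : C} : c = liftFun φ (frac a b) ↔ c ⊚ φ b = φ a :=
  eq_circ_circInv_iff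

theorem liftFun_frac_circ (a b : W) : liftFun φ (frac a b) ⊚ φ b = φ a :=
  (eq_liftFun_frac_iff φ).1 rfl

theorem liftFun_circ (p q : Fractions W) : liftFun φ (p ⊚ q) = liftFun φ p ⊚ liftFun φ q := by
  obtain ⟨a, b, rfl⟩ := exists_frac p
  obtain ⟨c, d, rfl⟩ := exists_frac q
  rw [frac_circ]
  refine ((eq_liftFun_frac_iff φ).2 ?_).symm
  calc liftFun φ (frac a b) ⊚ liftFun φ (frac c d) ⊚ φ (b ⊚ d)
      = (liftFun φ (frac a b) ⊚ φ b) ⊚ (liftFun φ (frac c d) ⊚ φ d) := by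
        rw [φ.map_circ]
        ac_rfl
    _ = φ (a ⊚ c) := by rw [liftFun_frac_circ, liftFun_frac_circ, φ.map_circ]

theorem liftFun_mul (p q : Fractions W) : liftFun φ (p * q) = liftFun φ p * liftFun φ q := by
  obtain ⟨a, b, rfl⟩ := exists_frac p
  obtain ⟨c, d, rfl⟩ := exists_frac q
  set x := liftFun φ (frac a b) with hx
  set y := liftFun φ (frac c d) with hy
  rw [frac_mul]
  refine ((eq_liftFun_frac_iff φ).2 ?_).symm
  calc (x * y) ⊚ φ (b ⊚ d)
      = x ⊚ (φ b ⊚ φ d) * (φ b ⊚ φ d)⁻¹ * y ⊚ (φ b ⊚ φ d) := by rw [φ.map_circ, Wire.mul_circ]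
    _ = (x ⊚ φ b) ⊚ φ d * (φ b ⊚ φ d)⁻¹ * (y ⊚ φ d) ⊚ φ b := by
        congr 1
        · congr 1
          ac_rfl
        · ac_rfl
    _ = φ (a ⊚ d * (b ⊚ d)⁻¹ * c ⊚ b) := by
        rw [hx, hy, liftFun_frac_circ, liftFun_frac_circ]
        simp only [map_mul, map_inv, φ.map_circ]

/-- The extension to fractions of a morphism from a commutative wire to a commutative skew
brace. -/
noncomputable def lift : WireHom (Fractions W) C where
  toMonoidHom := MonoidHom.mk' (liftFun φ) (liftFun_mul φ)
  map_circ' := liftFun_circ φ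

theorem lift_of (a : W) : lift φ (of W a) = φ a := by
  have h := liftFun_frac_circ φ a 1
  rwa [map_one, circ_one] at h

theorem hom_eq_of_eq_on_of {φ ψ : WireHom (Fractions W) C} (h : ∀ a, φ (of W a) = ψ (of W a)) :
    φ = ψ := by
  refine DFunLike.ext _ _ fun q => ?_
  obtain ⟨a, b, rfl⟩ := exists_frac q
  refine circ_right_cancel (c := ψ (of W b)) ?_
  rw [← ψ.map_circ, ← h b, ← φ.map_circ, frac_circ_of, h]

end Fractions

theorem isFreeCommSkewBrace_fractions (X : Type u) :
    IsFreeCommSkewBrace.{u, u, w} fun x : X => Fractions.frac (FreeCommWire.of x) 1 := by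
  intro C _ f
  refine ⟨Fractions.lift (FreeCommWire.lift f), ⟨WireHom.isSkewBraceHom _, fun x => ?_⟩, ?_⟩
  · exact (Fractions.lift_of _ _).trans (FreeCommWire.lift_of f x)
  · rintro ψ ⟨hψ, hx⟩
    have eq_lift : hψ.toWireHom = Fractions.lift (FreeCommWire.lift f) := by
      refine Fractions.hom_eq_of_eq_on_of fun a => ?_
      rw [Fractions.lift_of]
      have eq_lift_comp : hψ.toWireHom.comp (Fractions.of _) = FreeCommWire.lift f :=
        FreeCommWire.hom_eq_of_eq_on_of fun x => (hx x).trans (FreeCommWire.lift_of f x).symm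
      exact DFunLike.congr_fun eq_lift_comp a
    exact congrArg DFunLike.coe eq_lift


/-! ### Affine wires -/

/-- The commutative wire of a commutative ring `R` that consists of the affine permutations of `R`
with an invertible linear part. The pair `(u, y)` stands for `z ↦ u (z - 1) + y`, so that the
group operation is composition, and the circle operation multiplies the linear parts and the
values at `1`. -/
@[ext]
structure AffineWire (R : Type u) [CommRing R] where
  linear : Rˣ
  point : R

namespace AffineWire

variable {R : Type u} [CommRing R]

instance : Mul (AffineWire R) :=
  ⟨fun a b => ⟨a.linear * b.linear, a.linear * (b.point - 1) + a.point⟩⟩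

instance : One (AffineWire R) := ⟨⟨1, 1⟩⟩

instance : Inv (AffineWire R) :=
  ⟨fun a => ⟨a.linear⁻¹, ↑a.linear⁻¹ * (1 - a.point) + 1⟩⟩

instance : HasCirc (AffineWire R) := ⟨fun a b => ⟨a.linear * b.linear, a.point * b.point⟩⟩

theorem linear_mul (a b : AffineWire R) : (a * b).linear = a.linear * b.linear := rfl

theorem point_mul (a b : AffineWire R) :
    (a * b).point = a.linear * (b.point - 1) + a.point := rfl

theorem linear_one : (1 : AffineWire R).linear = 1 := rfl

theorem point_one : (1 : AffineWire R).point = 1 := rfl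

theorem linear_inv (a : AffineWire R) : a⁻¹.linear = a.linear⁻¹ := rfl

theorem point_inv (a : AffineWire R) :
    a⁻¹.point = ↑a.linear⁻¹ * (1 - a.point) + 1 := rfl

theorem linear_circ (a b : AffineWire R) : (a ⊚ b).linear = a.linear * b.linear := rfl

theorem point_circ (a b : AffineWire R) : (a ⊚ b).point = a.point * b.point := rfl

instance : Group (AffineWire R) :=
  Group.ofLeftAxioms
    (fun a b c => by
      ext
      · simp only [linear_mul, mul_assoc]
      · simp only [linear_mul, point_mul, Units.val_mul]
        ring)
    (fun a => by
      ext
      · simp only [linear_mul, linear_one, one_mul]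
      · simp only [point_mul, linear_one, point_one, Units.val_one]
        ring)
    (fun a => by
      ext
      · simp only [linear_mul, linear_inv, linear_one, inv_mul_cancel]
      · simp only [point_mul, linear_inv, point_inv, point_one]
        ring)

instance : CommWire (AffineWire R) where
  circ_assoc a b c := by
    ext
    · simp only [linear_circ, mul_assoc]
    · simp only [point_circ, mul_assoc]
  circ_mul a b c := by
    ext
    · simp only [linear_circ, linear_mul, linear_inv, mul_assoc, inv_mul_cancel_left]
    · simp only [linear_circ, point_circ, linear_mul, linear_inv, point_mul, point_inv,
        Units.val_mul]
      linear_combination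
        -(b.linear * (a.point * c.point - a.point) : R) * a.linear.mul_inv
  mul_circ a b c := by
    ext
    · simp only [linear_circ, linear_mul, linear_inv, mul_assoc, mul_inv_cancel_left,
        mul_comm c.linear]
    · simp only [linear_circ, point_circ, linear_mul, linear_inv, point_mul, point_inv,
        Units.val_mul]
      linear_combination
        -(b.linear * (a.point * c.point - a.point) : R) * a.linear.mul_inv
  circ_comm a b := by
    ext
    · simp only [linear_circ, mul_comm]
    · simp only [point_circ, mul_comm]

/-- The linear part as a group homomorphism. -/
def linearHom : AffineWire R →* Rˣ := MonoidHom.mk' linear linear_mul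

theorem circ_right_cancel [NoZeroDivisors R] {a b c : AffineWire R} (hc : c.point ≠ 0)
    (h : a ⊚ c = b ⊚ c) : a = b :=
  AffineWire.ext (mul_right_cancel (congrArg linear h))
    (mul_right_cancel₀ hc (congrArg point h))

/-- The affine permutations whose value at `1` is mapped to `1` by a ring homomorphism. -/
def unitPoint {S : Type v} [Ring S] (ε : R →+* S) : Subgroup (AffineWire R) where
  carrier := {a | ε a.point = 1}
  one_mem' := map_one ε
  mul_mem' {a b} ha hb := by
    rw [Set.mem_ofPred_eq] at ha hb ⊢
    rw [point_mul, map_add, map_mul, map_sub, map_one, ha, hb, sub_self, mul_zero, zero_add]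
  inv_mem' {a} ha := by
    rw [Set.mem_ofPred_eq] at ha ⊢
    rw [point_inv, map_add, map_mul, map_sub, map_one, ha, sub_self, mul_zero, zero_add]

end AffineWire

/-! ### The Magnus embedding -/

/-- Crossed homomorphisms from `G` to the functions `Q → A`, on which `G` acts by translations of
the argument along `π : G → Q`. -/
def IsCrossedHom {G : Type u} {Q : Type v} {A : Type w} [Monoid G] [Monoid Q] [Add A]
    (π : G →* Q) (c : Q → G → A) : Prop :=
  ∀ q g h, c q (g * h) = c q g + c (q * π g) h

namespace IsCrossedHom

variable {G : Type u} {Q : Type v} {A : Type w} [Monoid Q] [AddGroup A]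

theorem map_one [Monoid G] {π : G →* Q} {c : Q → G → A} (hc : IsCrossedHom π c) (q : Q) :
    c q 1 = 0 := by
  have h := hc q 1 1
  rwa [mul_one, _root_.map_one, mul_one, left_eq_add] at h

theorem map_inv [Group G] {π : G →* Q} {c : Q → G → A} (hc : IsCrossedHom π c) (q : Q) (g : G) :
    c q g⁻¹ = -c (q * π g⁻¹) g := by
  have h := hc q g⁻¹ g
  rw [inv_mul_cancel, hc.map_one] at h
  exact eq_neg_of_add_eq_zero_left h.symm

theorem eq_of_eq_on_of {S : Type u} {π : FreeGroup S →* Q} {c d : Q → FreeGroup S → A}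
    (hc : IsCrossedHom π c) (hd : IsCrossedHom π d)
    (h : ∀ q s, c q (FreeGroup.of s) = d q (FreeGroup.of s)) (q : Q) (g : FreeGroup S) :
    c q g = d q g := by
  induction g using FreeGroup.induction_on generalizing q with
  | C1 => rw [hc.map_one, hd.map_one]
  | of s => exact h q s
  | inv_of s => exact (hc.map_inv q _).trans ((congrArg _ (h _ s)).trans (hd.map_inv q _).symm)
  | mul v w hv hw => rw [hc, hd, hv, hw]

end IsCrossedHom

section Schreier

variable {G : Type u} [Group G] {N : Subgroup G} [N.Normal]

theorem out_mul_mul_inv_out_mem (q : G ⧸ N) (g : G) :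
    q.out * g * (q * (g : G ⧸ N)).out⁻¹ ∈ N := by
  rw [← QuotientGroup.eq_one_iff]
  simp only [QuotientGroup.mk_mul, QuotientGroup.mk_inv, QuotientGroup.out_eq', mul_inv_cancel]

/-- The class in `N / [N, N]` of the Schreier generator attached to the coset `q` and to `g`,
with respect to the transversal `Quotient.out`. -/
noncomputable def schreierClass (q : G ⧸ N) (g : G) : Additive (Abelianization N) :=
  .ofMul (Abelianization.of ⟨_, out_mul_mul_inv_out_mem q g⟩)

theorem isCrossedHom_schreierClass :
    IsCrossedHom (QuotientGroup.mk' N) (schreierClass (N := N)) := by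
  intro q g h
  rw [schreierClass, schreierClass, schreierClass, ← ofMul_mul, ← map_mul]
  congr 2
  apply Subtype.ext
  simp only [Subgroup.coe_mul, QuotientGroup.mk'_apply, QuotientGroup.mk_mul, mul_assoc,
    inv_mul_cancel_left]

theorem mem_commutator_of_schreierClass_eq_zero {g : G} (hg : g ∈ N)
    (h : schreierClass (N := N) 1 g = 0) : g ∈ ⁅N, N⁆ := by
  have mem_commutator : (⟨_, out_mul_mul_inv_out_mem 1 g⟩ : N) ∈ commutator N := by
    rw [← Abelianization.ker_of]
    exact h
  have conj_mem : (1 : G ⧸ N).out * g * (1 : G ⧸ N).out⁻¹ ∈ ⁅N, N⁆ := by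
    rw [← Subgroup.map_subtype_commutator]
    exact ⟨_, mem_commutator, by simp [(QuotientGroup.eq_one_iff g).2 hg]⟩
  rwa [mul_assoc, Subgroup.Normal.mem_comm_iff inferInstance, inv_mul_cancel_right] at conj_mem

end Schreier

/-- Magnus' theorem. The two sides of `hD` extend to crossed homomorphisms in the word, which
agree because they do so on the generators; at the word `w` the one on the left vanishes. -/
theorem mem_commutator_of_affineWire_eq_one {S : Type u} {N : Subgroup (FreeGroup S)} [N.Normal]
    {R : Type v} [CommRing R] {χ : FreeGroup S ⧸ N →* Rˣ} (hχ : Function.Injective χ)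
    {φ : FreeGroup S →* AffineWire R}
    (hφ : ∀ s, (φ (FreeGroup.of s)).linear = χ (FreeGroup.of s : FreeGroup S))
    (D : R →+ Additive (Abelianization N))
    (hD : ∀ q s, D (χ q * ((φ (FreeGroup.of s)).point - 1)) = schreierClass q (FreeGroup.of s))
    {w : FreeGroup S} (hw : φ w = 1) : w ∈ ⁅N, N⁆ := by
  have linear_eq (g : FreeGroup S) : (φ g).linear = χ g :=
    DFunLike.congr_fun (FreeGroup.ext_hom (AffineWire.linearHom.comp φ)
      (χ.comp (QuotientGroup.mk' N)) hφ) g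
  have crossed : IsCrossedHom (QuotientGroup.mk' N) fun q g => D (χ q * ((φ g).point - 1)) := by
    intro q g h
    beta_reduce
    rw [← map_add, map_mul φ, AffineWire.point_mul, linear_eq, QuotientGroup.mk'_apply, map_mul χ,
      Units.val_mul]
    congr 1
    ring
  refine mem_commutator_of_schreierClass_eq_zero ?_ ?_
  · rw [← QuotientGroup.eq_one_iff]
    refine hχ ?_
    rw [← linear_eq, hw, AffineWire.linear_one, map_one]
  · rw [← crossed.eq_of_eq_on_of isCrossedHom_schreierClass hD, hw, AffineWire.point_one, sub_self,
      mul_zero, map_zero]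

/-! ### The Magnus representation of `F / N'` -/

namespace PolyGroup

variable {X : Type u}

instance : CommGroup (PolyGroup X ⧸ N X) where
  mul_comm a b := by
    obtain ⟨x, rfl⟩ := QuotientGroup.mk_surjective a
    obtain ⟨y, rfl⟩ := QuotientGroup.mk_surjective b
    rw [← mul_inv_eq_iff_eq_mul]
    exact mk_map_eq (MulAut.conj x).toMonoidHom (FreeCommWire.conj_mod x) y

/-- The exponent vector of a monomial. -/
noncomputable def monExponent (m : FreeCommSemigroup X) : Multiplicative (X →₀ ℤ) :=
  .ofAdd (m.1.map fun x => Finsupp.single x 1).sum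

theorem monExponent_of (x : X) :
    monExponent (FreeCommSemigroup.of x) = .ofAdd (Finsupp.single x 1) := by
  rw [monExponent, FreeCommSemigroup.of, Multiset.map_singleton, Multiset.sum_singleton]

theorem monExponent_mul (m l : FreeCommSemigroup X) :
    monExponent (m * l) = monExponent m * monExponent l := by
  change Multiplicative.ofAdd ((m.1 + l.1).map _).sum = _
  rw [Multiset.map_add, Multiset.sum_add]
  rfl

/-- The isomorphism of `F / N` with the free abelian group on `X`. -/
noncomputable def exponent : PolyGroup X ⧸ N X →* Multiplicative (X →₀ ℤ) :=
  QuotientGroup.lift (N X) (FreeGroup.lift monExponent) <| by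
    refine Subgroup.normalClosure_le_normal ?_
    rintro _ ⟨m, l, rfl⟩
    rw [SetLike.mem_coe, MonoidHom.mem_ker, map_mul, map_mul, map_inv, map_inv,
      FreeGroup.lift_apply_of, FreeGroup.lift_apply_of, FreeGroup.lift_apply_of, monExponent_mul,
      inv_mul_cancel_left, mul_inv_cancel]

theorem exponent_mon (m : FreeCommSemigroup X) :
    exponent (QuotientGroup.mk (mon m)) = monExponent m :=
  FreeGroup.lift_apply_of

/-- The inverse of `exponent`. -/
noncomputable def ofExponent : Multiplicative (X →₀ ℤ) →* PolyGroup X ⧸ N X :=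
  AddMonoidHom.toMultiplicativeLeft (Finsupp.liftAddHom fun x : X =>
    zmultiplesHom _ (Additive.ofMul (QuotientGroup.mk (mon (FreeCommSemigroup.of x)))))

theorem ofExponent_single (x : X) : ofExponent (.ofAdd (Finsupp.single x 1)) =
    QuotientGroup.mk (mon (FreeCommSemigroup.of x)) := by
  simp [ofExponent]

theorem ofExponent_exponent (a : PolyGroup X ⧸ N X) : ofExponent (exponent a) = a := by
  suffices h : ofExponent.comp exponent = MonoidHom.id (PolyGroup X ⧸ N X) from
    DFunLike.congr_fun h a
  refine QuotientGroup.monoidHom_ext _ (FreeGroup.ext_hom _ _ fun m => ?_)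
  change ofExponent (exponent (QuotientGroup.mk (mon m))) = QuotientGroup.mk (mon m)
  rw [exponent_mon]
  induction m using FreeCommSemigroup.induction_on with
  | of x => rw [monExponent_of, ofExponent_single]
  | of_mul x m ih =>
    rw [monExponent_mul, map_mul, ih, monExponent_of, ofExponent_single, mk_mul_mon]

instance : UniqueProds (PolyGroup X ⧸ N X) :=
  UniqueProds.of_injective_mulHom exponent.toMulHom
    (Function.LeftInverse.injective ofExponent_exponent) inferInstance

end PolyGroup

instance {X : Type u} : UniqueSums (Multiset X) := by
  classical
  exact UniqueSums.of_injective_addHom (Multiset.toFinsupp (α := X)).toAddMonoidHom.toAddHom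
    Multiset.toFinsupp.injective inferInstance

namespace FreeCommWire

open PolyGroup

variable {X : Type u}

variable (X) in
/-- The group ring of `F / N` times the free commutative monoid on `X`. -/
abbrev MagnusRing : Type u :=
  MonoidAlgebra ℤ ((PolyGroup X ⧸ N X) × Multiplicative (Multiset X))

/-- The elements of `F / N` as units of the Magnus ring. -/
noncomputable def groupUnit : PolyGroup X ⧸ N X →* (MagnusRing X)ˣ :=
  ((MonoidAlgebra.of ℤ _).comp (MonoidHom.inl _ _)).toHomUnits

theorem coe_groupUnit (q : PolyGroup X ⧸ N X) :
    (groupUnit q : MagnusRing X) = MonoidAlgebra.single (q, 1) 1 := rfl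

theorem groupUnit_injective : Function.Injective (groupUnit (X := X)) := fun _ _ h =>
  congrArg Prod.fst (MonoidAlgebra.of_injective (congrArg Units.val h))

/-- The affine permutation `z ↦ [m] (z - 1) + m` of the Magnus ring. -/
noncomputable def magnusMon (m : FreeCommSemigroup X) : AffineWire (MagnusRing X) :=
  ⟨groupUnit (QuotientGroup.mk (mon m)), MonoidAlgebra.single (1, .ofAdd m.1) 1⟩

theorem magnusMon_mul (m l : FreeCommSemigroup X) :
    magnusMon (m * l) = magnusMon m ⊚ magnusMon l := by
  refine AffineWire.ext ?_ ?_
  · rw [AffineWire.linear_circ, magnusMon, mk_mul_mon, map_mul]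
    rfl
  · rw [AffineWire.point_circ, magnusMon, magnusMon, magnusMon, MonoidAlgebra.single_mul_single,
      Prod.mk_mul_mk, mul_one, mul_one]
    rfl

/-- The morphism from `F / N'` to the affine permutations of the Magnus ring. -/
noncomputable def magnus : WireHom (FreeCommWire X) (AffineWire (MagnusRing X)) :=
  liftMon magnusMon magnusMon_mul

theorem magnus_mon (m : FreeCommSemigroup X) : magnus (mk (mon m)) = magnusMon m :=
  liftMon_mon _ _ m

open Classical in
/-- The additive map that sends `q (m - 1)`, for `q ∈ F / N` and a monomial `m`, to the class of
the Schreier generator of `q` and `m`. -/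
noncomputable def schreierHom : MagnusRing X →+ Additive (Abelianization (N X)) :=
  (Finsupp.liftAddHom fun p => zmultiplesHom _
    (if h : p.2.toAdd ≠ 0 then schreierClass p.1 (mon ⟨_, h⟩) else 0)).comp
    MonoidAlgebra.coeffAddEquiv.toAddMonoidHom

open Classical in
theorem schreierHom_single (q : PolyGroup X ⧸ N X) (s : Multiplicative (Multiset X)) :
    schreierHom (MonoidAlgebra.single (q, s) 1) =
      if h : s.toAdd ≠ 0 then schreierClass q (mon ⟨_, h⟩) else 0 := by
  simp only [schreierHom, AddMonoidHom.comp_apply, AddEquiv.coe_toAddMonoidHom,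
    MonoidAlgebra.coeffAddEquiv_apply, MonoidAlgebra.coeff_single,
    Finsupp.liftAddHom_apply_single, zmultiplesHom_apply, one_smul]

theorem schreierHom_magnusMon (q : PolyGroup X ⧸ N X) (m : FreeCommSemigroup X) :
    schreierHom ((groupUnit q : MagnusRing X) * ((magnusMon m).point - 1)) =
      schreierClass q (mon m) := by
  have single_mul_point : (groupUnit q : MagnusRing X) * (magnusMon m).point =
      MonoidAlgebra.single (q, .ofAdd m.1) 1 := by
    simp only [coe_groupUnit, magnusMon, MonoidAlgebra.single_mul_single, Prod.mk_mul_mk, mul_one,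
      one_mul]
  have hm : (Multiplicative.ofAdd m.1).toAdd ≠ 0 := m.2
  rw [mul_sub, mul_one, map_sub, single_mul_point, coe_groupUnit, schreierHom_single,
    schreierHom_single, dif_pos hm, dif_neg (not_not_intro toAdd_one), sub_zero]
  rfl

theorem magnus_injective : Function.Injective (magnus (X := X)) := by
  refine (injective_iff_map_eq_one magnus).2 fun a ha => ?_
  obtain ⟨w, rfl⟩ := mk_surjective a
  refine (QuotientGroup.eq_one_iff w).2 ?_
  refine mem_commutator_of_affineWire_eq_one (φ := magnus.toMonoidHom.comp mk)
    groupUnit_injective (fun m => ?_) schreierHom (fun q m => ?_) ha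
  · exact congrArg AffineWire.linear (magnus_mon m)
  · rw [← schreierHom_magnusMon, ← magnus_mon]
    rfl

/-- The augmentation of the Magnus ring. -/
noncomputable def augmentation : MagnusRing X →+* ℤ := (MonoidAlgebra.lift ℤ ℤ _ 1).toRingHom

theorem augmentation_magnus_point (a : FreeCommWire X) : augmentation (magnus a).point = 1 := by
  have closure_le : Subgroup.closure (Set.range fun m => (mk (mon m) : FreeCommWire X)) ≤
      (AffineWire.unitPoint augmentation).comap magnus.toMonoidHom := by
    refine (Subgroup.closure_le _).2 (Set.range_subset_iff.2 fun m => ?_)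
    change augmentation (magnus (mk (mon m))).point = 1
    rw [magnus_mon]
    simp [augmentation, magnusMon]
  exact closure_le (closure_range_mon ▸ Subgroup.mem_top a)

theorem circ_right_cancel {a b c : FreeCommWire X} (h : a ⊚ c = b ⊚ c) : a = b := by
  have magnus_point_ne_zero : (magnus c).point ≠ 0 := by
    intro h0
    simpa [h0] using augmentation_magnus_point c
  refine magnus_injective (AffineWire.circ_right_cancel magnus_point_ne_zero ?_)
  rw [← magnus.map_circ, h, magnus.map_circ]

end FreeCommWire

theorem theorem3 (X : Type u) :
    -- `(F / N', ∘)` is cancellative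
    (∀ a b c : FreeCommWire X, a ⊚ c = b ⊚ c → a = b) ∧
    -- the elements of the skew brace of fractions are the fractions `a / b`
    (∀ q : Fractions (FreeCommWire X), ∃ a b : FreeCommWire X, q = Fractions.frac a b) ∧
    -- equality of fractions
    (∀ a b a₁ b₁ : FreeCommWire X,
      Fractions.frac a b = Fractions.frac a₁ b₁ ↔ a ⊚ b₁ = b ⊚ a₁) ∧
    -- the two operations
    (∀ a b a₁ b₁ : FreeCommWire X,
      Fractions.frac a b * Fractions.frac a₁ b₁ =
        Fractions.frac (a ⊚ b₁ * (b ⊚ b₁)⁻¹ * b ⊚ a₁) (b ⊚ b₁)) ∧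
    (∀ a b a₁ b₁ : FreeCommWire X,
      Fractions.frac a b ⊚ Fractions.frac a₁ b₁ = Fractions.frac (a ⊚ a₁) (b ⊚ b₁)) ∧
    -- the skew brace of fractions is the free commutative skew brace on `X`
    IsFreeCommSkewBrace.{u, u, w} fun x : X => Fractions.frac (FreeCommWire.of x) 1 := by
  exact ⟨fun _ _ _ => FreeCommWire.circ_right_cancel, Fractions.exists_frac,
    fun _ _ _ _ => Fractions.frac_eq_frac_iff fun _ _ _ => FreeCommWire.circ_right_cancel,
    fun a b a₁ b₁ => by rw [Fractions.frac_mul, CommWire.circ_comm b a₁], Fractions.frac_circ,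
    isFreeCommSkewBrace_fractions X⟩
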